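/- Let $U_h(sl(2))$ be the Jordanian algebra, i.e. the $h$-adically complete $\mathbb{C}[[h]]$-algebra topologically generated by $X,Y,H$ with relations $$[H,X]=\tfrac{2}{h}\sinh hX,\qquad [H,Y]=-Y\cosh hX-\cosh hX\,Y,\qquad [X,Y]=H,$$ and let $T=e^{hX}$. By a function of $T$ we mean an element of $\mathbb{C}[X][[h]]\ni T$ (a formal power series in $h$ whose coefficients are polynomials in $X=h^{-1}\log T$); put $f'=df/dT=(hT)^{-1}\,\partial f/\partial X$, an element of the field of fractions of $\mathbb{C}[X][[h]]$. The limit $h\to0$ of $f$ is its constant coefficient in $h$. Let $f_1$ be a function of $T$ with $f_1\to X$ as $h\to 0$. For functions $f_2,f_3,u,v,w$ of $T$ with $(f_2,f_3;u,v,w)\to(1,1;0,0,0)$ as $h\to0$, consider in $U_h(sl(2))$ the elements $$J_+=f_1,\qquad J_0=f_2H,\qquad J_-=f_3Y+u+vH+wH^2 .$$ (i) These elements satisfy the $sl(2)$ relations $[J_0,J_\pm]=\pm2J_\pm$, $[J_+,J_-]=J_0$ if and only if $$f_2=\frac{2}{T^2-1}\,\frac{f_1}{f_1'},\qquad f_3=\frac{1}{2h}\,\frac{T-T^{-1}}{f_1},\qquad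 u=-\frac{(T-T^{-1})^2}{16f_1},$$ $$v=-\frac12\left(\frac{f_2'}{f_1'}-\frac{f_2}{f_1}+\frac{T+T^{-1}}{2f_1}\right),\qquad w=\frac{1}{4f_1}\,(1-f_2^2)$$ (identities in the field of fractions of $\mathbb{C}[X][[h]]$). (ii) Such $f_2,f_3,u,v,w$ exist for the given $f_1$ if and only if $f_1$ vanishes at $T=1$ (that is, at $X=0$), and in that case they are unique; thus the choice of $f_1$ determines the map uniquely. -/

import Mathlib

noncomputable section

namespace Jordanian

/-- The three generators of `U_h(sl(2))`. -/
inductive Gen : Type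
  | X
  | Y
  | H

/-- `ℂ[X]⟦h⟧`: the ring of functions of `X`, equivalently of `T = e^{hX}`, inside the `h`-adically
complete algebra `U_h(sl(2))`. The power series variable is `h`, the polynomial variable is `X`. -/
abbrev Fun : Type := PowerSeries (Polynomial ℂ)

/-- The deformation parameter `h`, as a function (constant in `X`). -/
def hF : Fun := PowerSeries.X

/-- `T = e^{hX} = ∑ₙ hⁿ Xⁿ / n!`. -/
def T : Fun := PowerSeries.mk fun n => Polynomial.monomial n ((n.factorial : ℂ)⁻¹)

/-- `T⁻¹ = e^{-hX}`. -/
def Tinv : Fun := PowerSeries.mk fun n => Polynomial.monomial n ((-1) ^ n * (n.factorial : ℂ)⁻¹)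

/-- `cosh (hX) = (e^{hX} + e^{-hX}) / 2`. -/
def coshHX : Fun := (2⁻¹ : ℂ) • (T + Tinv)

/-- `sinh (hX) / h = ∑ₖ h²ᵏ X²ᵏ⁺¹ / (2k+1)!`. -/
def sinhHXdivH : Fun := PowerSeries.mk fun n =>
  if Even n then Polynomial.monomial (n + 1) (((n + 1).factorial : ℂ)⁻¹) else 0

/-- The `h`-adically complete free algebra `ℂ⟨X, Y, H⟩⟦h⟧`, with `h` central. -/
abbrev FreeSeries : Type := PowerSeries (FreeAlgebra ℂ Gen)

/-- A generator, as an element of `ℂ⟨X, Y, H⟩⟦h⟧`. -/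
def gen (g : Gen) : FreeSeries := PowerSeries.C (FreeAlgebra.ι ℂ g)

/-- Evaluation `f ↦ f(X)` of a function at the generator `X`. -/
def funToFree : Fun →+* FreeSeries :=
  PowerSeries.map (Polynomial.aeval (R := ℂ) (FreeAlgebra.ι ℂ Gen.X)).toRingHom

/-- The defining relations of `U_h(sl(2))`:
`[H, X] = (2/h) sinh hX`, `[H, Y] = -Y cosh hX - cosh hX Y`, `[X, Y] = H`,
each as left side minus right side. -/
def relators : Set FreeSeries :=
  { gen .H * gen .X - gen .X * gen .H - 2 * funToFree sinhHXdivH,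
    gen .H * gen .Y - gen .Y * gen .H
      - (-(gen .Y * funToFree coshHX) - funToFree coshHX * gen .Y),
    gen .X * gen .Y - gen .Y * gen .X - gen .H }

/-- The `h`-adic closure `⋂ₙ (I + hⁿ A)` of the two-sided ideal `I` generated by the relations. -/
def closedIdeal : TwoSidedIdeal FreeSeries :=
  ⨅ n : ℕ, TwoSidedIdeal.span (relators ∪ {(PowerSeries.X : FreeSeries) ^ n})

/-- The Jordanian algebra `U_h(sl(2))`: the topological `ℂ⟦h⟧`-algebra generated by `X`, `Y`, `H`
subject to the defining relations. -/
abbrev Uh : Type := closedIdeal.ringCon.Quotient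

/-- The quotient map onto `U_h(sl(2))`. -/
def toUh : FreeSeries →+* Uh := closedIdeal.ringCon.mk'

/-- The generator `H` of `U_h(sl(2))`. -/
def H : Uh := toUh (gen .H)

/-- The generator `Y` of `U_h(sl(2))`. -/
def Y : Uh := toUh (gen .Y)

/-- A function of `T`, as an element of `U_h(sl(2))`. -/
def op : Fun →+* Uh := toUh.comp funToFree

/-- The classical limit `h → 0` of a function. -/
def classicalLimit (f : Fun) : Polynomial ℂ := PowerSeries.constantCoeff f

/-- The value of a function at `X = 0`, that is at `T = 1`; an element of `ℂ⟦h⟧`. -/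
def valueAtOne (f : Fun) : PowerSeries ℂ := PowerSeries.map (Polynomial.evalRingHom (0 : ℂ)) f

/-- The functions `f₂, f₃, u, v, w` of the ansatz; the function `f₁` is kept separate. -/
structure Coeffs : Type where
  f₂ : Fun
  f₃ : Fun
  u : Fun
  v : Fun
  w : Fun

/-- `J₊ = f₁`. -/
def Jplus (f₁ : Fun) : Uh := op f₁

/-- `J₀ = f₂ H`. -/
def Jzero (p : Coeffs) : Uh := op p.f₂ * H

/-- `J₋ = f₃ Y + u + v H + w H²`. -/
def Jminus (p : Coeffs) : Uh := op p.f₃ * Y + op p.u + op p.v * H + op p.w * H ^ 2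

/-- The classical `sl(2)` relations `[J₀, J₊] = 2J₊`, `[J₀, J₋] = -2J₋`, `[J₊, J₋] = J₀`. -/
def SatisfiesSl2 {A : Type*} [Ring A] (Jp J0 Jm : A) : Prop :=
  J0 * Jp - Jp * J0 = 2 * Jp ∧ J0 * Jm - Jm * J0 = -(2 * Jm) ∧ Jp * Jm - Jm * Jp = J0

/-- `(f₂, f₃; u, v, w) → (1, 1; 0, 0, 0)` as `h → 0`. -/
def Coeffs.HasClassicalLimits (p : Coeffs) : Prop :=
  classicalLimit p.f₂ = 1 ∧ classicalLimit p.f₃ = 1 ∧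
    classicalLimit p.u = 0 ∧ classicalLimit p.v = 0 ∧ classicalLimit p.w = 0

/-- The field of fractions of the ring of functions. -/
abbrev K : Type := FractionRing Fun

/-- A function, as an element of the field of fractions. -/
def frac : Fun →+* K := algebraMap Fun K

/-- The derivative `∂f/∂X`, taken coefficientwise in `h`. -/
def derivX (f : Fun) : Fun := PowerSeries.mk fun n => Polynomial.derivative (PowerSeries.coeff n f)

/-- The derivative `f′ = df/dT`. As `T = e^{hX}`, one has `dT/dX = hT`, so that
`df/dT = (∂f/∂X) / (hT)`. -/
def derivT (f : Fun) : K := frac (derivX f) / (frac hF * frac T)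

/-- The explicit expressions for `f₂, f₃, u, v, w` in terms of `f₁`, as identities in the field of
fractions of the ring of functions. -/
def IsGeneralSolution (f₁ : Fun) (p : Coeffs) : Prop :=
  frac p.f₂ = 2 / (frac T ^ 2 - 1) * (frac f₁ / derivT f₁) ∧
  frac p.f₃ = 1 / (2 * frac hF) * ((frac T - (frac T)⁻¹) / frac f₁) ∧
  frac p.u = -((frac T - (frac T)⁻¹) ^ 2 / (16 * frac f₁)) ∧
  frac p.v = -(1 / 2) * (derivT p.f₂ / derivT f₁ - frac p.f₂ / frac f₁
    + (frac T + (frac T)⁻¹) / (2 * frac f₁)) ∧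
  frac p.w = 1 / (4 * frac f₁) * (1 - frac p.f₂ ^ 2)

end Jordanian

end

/-!
Every element of the form `J₊, J₀, J₋`, and every commutator of two of them, can be put in the
normal form `a Y + b + c H + e H²` with functions `a, b, c, e` of `X` on the left. The rules for
this are `[H, f] = s ∂f` and `[f, Y] = ∂f H + (s/2) ∂²f`, with `s = (2/h) sinh hX` and `∂ = ∂/∂X`
(`H_mul_smul`, `Y_mul_smul`). They follow for polynomials from the defining relations and the
Leibniz rule, and for all functions because `U_h(sl(2))` is `h`-adically separated.

The coefficients of the normal form are unique (`normalForm_eq_zero`). To see this, let `X` act on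
functions by multiplication, `H` by `s ∂ + λ cosh hX` and `Y` by `-(s/2) ∂² - λ cosh hX ∂ + (1 - λ²)
h² s / 8`, where `λ` is a constant. These operators satisfy the relations. In the image of a
vanishing normal form the coefficient of each power of `∂` is zero, and comparing three values of
`λ` shows that `a, b, c, e` are zero. For the representation to be defined on the completed algebra,
the operators are taken in `End(ℂ[X])⟦h⟧`.

Hence the `sl(2)` relations are a system of equations between `f₁, f₂, f₃, u, v, w` and their
derivatives (`satisfiesSl2_iff_coeffEqs`). The relation `[J₀, J₊] = 2 J₊` reads `f₂ s ∂f₁ = 2 f₁`,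
which determines `f₂`, and shows at `X = 0` that `f₁` vanishes there and, after differentiating,
that `f₂ = 1` there. The remaining equations contain `∂(f₂² + 4 w f₁) = 0` and `∂(16 u f₁ + h² s²) =
0`; the values at `X = 0` fix both constants of integration, and `f₃` and `v` are then given by the
relation `[J₊, J₋] = J₀`. Conversely the resulting expressions solve the system
(`CoeffEqs.clearedSolution`, `ClearedSolution.coeffEqs`). When `f₁` vanishes at `X = 0` all the
divisions can be carried out in `ℂ[X]⟦h⟧` (`exists_clearedSolution`).
-/

noncomputable section

namespace Jordanian

open PowerSeries

/-! ### Calculus of functions of `X` -/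

lemma coeff_derivX (f : Fun) (n : ℕ) :
    coeff n (derivX f) = Polynomial.derivative (coeff n f) := coeff_mk _ _

lemma derivX_add (f g : Fun) : derivX (f + g) = derivX f + derivX g := by
  ext1 n; simp [coeff_derivX]

lemma derivX_mul (f g : Fun) : derivX (f * g) = derivX f * g + f * derivX g := by
  ext1 n
  simp [coeff_derivX, coeff_mul, Finset.sum_add_distrib]

/-- `derivX`, that is `∂/∂X`, as a derivation of the ring of functions. -/
def dX : Derivation ℂ Fun Fun :=
  Derivation.mk'
    { toFun := derivX
      map_add' := derivX_add
      map_smul' := fun c f => by ext1 n; simp [coeff_derivX] }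
    fun f g => by
      change derivX (f * g) = f • derivX g + g • derivX f
      rw [derivX_mul, smul_eq_mul, smul_eq_mul]; ring

lemma derivX_eq (f : Fun) : derivX f = dX f := rfl

lemma coeff_dX (f : Fun) (n : ℕ) : coeff n (dX f) = Polynomial.derivative (coeff n f) :=
  coeff_derivX f n

lemma dX_mul (f g : Fun) : dX (f * g) = dX f * g + f * dX g := derivX_mul f g

lemma dX_C (p : Polynomial ℂ) : dX (C p) = C (Polynomial.derivative p) := by
  ext1 n; rw [coeff_dX, coeff_C, coeff_C]; split_ifs <;> simp

@[simp] lemma dX_hF : dX hF = 0 := by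
  ext1 n; rw [coeff_dX, hF, coeff_X]; split_ifs <;> simp

@[simp] lemma dX_ofNat (n : ℕ) [n.AtLeastTwo] : dX (ofNat(n) : Fun) = 0 :=
  dX.map_natCast n

lemma dX_T : dX T = hF * T := by
  ext1 n
  rw [coeff_dX, T, coeff_mk, hF]
  cases n with
  | zero => simp
  | succ n =>
    rw [coeff_succ_X_mul, coeff_mk, Polynomial.derivative_monomial, Nat.factorial_succ]
    congr 1
    push_cast
    have h1 : (n.factorial : ℂ) ≠ 0 := by exact_mod_cast n.factorial_ne_zero
    have h2 : ((n : ℂ) + 1) ≠ 0 := by exact_mod_cast n.succ_ne_zero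
    field_simp

lemma dX_Tinv : dX Tinv = -(hF * Tinv) := by
  ext1 n
  rw [coeff_dX, Tinv, coeff_mk, hF, map_neg]
  cases n with
  | zero => simp
  | succ n =>
    rw [coeff_succ_X_mul, coeff_mk, Polynomial.derivative_monomial, Nat.factorial_succ, ← map_neg]
    congr 1
    push_cast
    have h1 : (n.factorial : ℂ) ≠ 0 := by exact_mod_cast n.factorial_ne_zero
    have h2 : ((n : ℂ) + 1) ≠ 0 := by exact_mod_cast n.succ_ne_zero
    field_simp
    ring

lemma two_mul_coshHX : 2 * coshHX = T + Tinv := by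
  rw [coshHX, two_mul, ← add_smul]
  norm_num

instance : CharZero Fun := charZero_of_injective_algebraMap (algebraMap ℂ Fun).injective

lemma dX_sinhHXdivH : dX sinhHXdivH = coshHX := by
  refine mul_left_cancel₀ (two_ne_zero (α := Fun)) ?_
  rw [two_mul_coshHX]
  ext1 n
  rw [two_mul, map_add, ← two_mul, coeff_dX, sinhHXdivH, coeff_mk, T, Tinv, map_add, coeff_mk,
    coeff_mk, ← map_add, apply_ite Polynomial.derivative, Polynomial.derivative_monomial,
    Nat.factorial_succ]
  have h1 : (n.factorial : ℂ) ≠ 0 := by exact_mod_cast n.factorial_ne_zero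
  have h2 : ((n : ℂ) + 1) ≠ 0 := by exact_mod_cast n.succ_ne_zero
  split_ifs with hn
  · rw [hn.neg_one_pow, ← map_ofNat Polynomial.C 2, Polynomial.C_mul_monomial]
    congr 1
    push_cast
    field_simp
    norm_num
  · rw [(Nat.not_even_iff_odd.1 hn).neg_one_pow]; simp

lemma two_mul_hF_mul_sinhHXdivH : 2 * (hF * sinhHXdivH) = T - Tinv := by
  ext1 n
  rw [two_mul, map_add, ← two_mul, hF, map_sub, T, Tinv, coeff_mk, coeff_mk]
  cases n with
  | zero => simp
  | succ n =>
    rw [coeff_succ_X_mul, sinhHXdivH, coeff_mk, ← map_sub]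
    split_ifs with hn
    · rw [hn.add_one.neg_one_pow, ← map_ofNat Polynomial.C 2, Polynomial.C_mul_monomial]
      congr 1; ring
    · rw [(Nat.not_even_iff_odd.1 hn).add_one.neg_one_pow]; simp

lemma dX_coshHX : dX coshHX = hF ^ 2 * sinhHXdivH := by
  have h : (2 : Fun) * dX coshHX = 2 * (hF ^ 2 * sinhHXdivH) := by
    have := congrArg dX two_mul_coshHX
    rw [dX_mul, dX_ofNat, map_add, dX_T, dX_Tinv] at this
    linear_combination this - hF * two_mul_hF_mul_sinhHXdivH
  exact mul_left_cancel₀ two_ne_zero h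

/-- `valueAtOne`, the evaluation at `X = 0`, as a ring homomorphism. -/
def evalOne : Fun →+* PowerSeries ℂ := PowerSeries.map (Polynomial.evalRingHom (0 : ℂ))

lemma valueAtOne_eq (f : Fun) : valueAtOne f = evalOne f := rfl

lemma coeff_evalOne (f : Fun) (n : ℕ) : coeff n (evalOne f) = (coeff n f).eval 0 := by
  simp [evalOne]

lemma evalOne_C_X : evalOne (C Polynomial.X) = 0 := by
  simp [evalOne]

/-- A function which vanishes at `X = 0` is divisible by `X`. -/
lemma exists_eq_C_X_mul {f : Fun} (h : evalOne f = 0) : ∃ g : Fun, f = C Polynomial.X * g := by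
  refine ⟨PowerSeries.mk fun n => (coeff n f).divX, ?_⟩
  ext1 n
  have h0 : (coeff n f).coeff 0 = 0 := by
    rw [Polynomial.coeff_zero_eq_eval_zero, ← coeff_evalOne, h, map_zero]
  rw [coeff_C_mul, coeff_mk]
  conv_lhs => rw [← Polynomial.X_mul_divX_add (coeff n f), h0]
  simp

/-- A function with zero derivative which vanishes at `X = 0` is zero. -/
lemma eq_zero_of_dX_eq_zero {f : Fun} (hd : dX f = 0) (h0 : evalOne f = 0) : f = 0 := by
  ext1 n
  have h1 : Polynomial.derivative (coeff n f) = 0 := by rw [← coeff_dX, hd, map_zero]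
  have h2 : (coeff n f).eval 0 = 0 := by rw [← coeff_evalOne, h0, map_zero]
  rw [Polynomial.eq_C_of_natDegree_eq_zero (Polynomial.derivative_eq_zero.1 h1)] at h2 ⊢
  rw [Polynomial.eval_C] at h2
  rw [h2, map_zero, map_zero]

lemma evalOne_T : evalOne T = 1 := by
  ext n
  rw [coeff_evalOne, T, coeff_mk, coeff_one]
  rcases n with _ | n <;> simp

lemma evalOne_Tinv : evalOne Tinv = 1 := by
  ext n
  rw [coeff_evalOne, Tinv, coeff_mk, coeff_one]
  rcases n with _ | n <;> simp

lemma evalOne_sinhHXdivH : evalOne sinhHXdivH = 0 := by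
  ext n
  rw [coeff_evalOne, sinhHXdivH, coeff_mk]
  split_ifs <;> simp

lemma evalOne_coshHX : evalOne coshHX = 1 := by
  have h := congrArg evalOne two_mul_coshHX
  rw [map_mul, map_add, evalOne_T, evalOne_Tinv, map_ofNat, one_add_one_eq_two] at h
  have h2 : (2 : PowerSeries ℂ) = C 2 := (map_ofNat C 2).symm
  have h3 : (C (2⁻¹ : ℂ)) * (2 : PowerSeries ℂ) = 1 := by rw [h2, ← map_mul]; norm_num
  linear_combination C (2⁻¹ : ℂ) * h + (1 - evalOne coshHX) * h3

lemma T_mul_Tinv : T * Tinv = 1 := by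
  -- Both sides have derivative `0` and agree at `X = 0`.
  rw [← sub_eq_zero]
  apply eq_zero_of_dX_eq_zero
  · rw [map_sub, dX_mul, dX_T, dX_Tinv, Derivation.map_one_eq_zero]; ring
  · rw [map_sub, map_mul, map_one, evalOne_T, evalOne_Tinv]; ring

lemma coshHX_sq : coshHX ^ 2 = 1 + hF ^ 2 * sinhHXdivH ^ 2 := by
  refine mul_left_cancel₀ (OfNat.ofNat_ne_zero 4 : (4 : Fun) ≠ 0) ?_
  linear_combination (2 * coshHX + T + Tinv) * two_mul_coshHX + 4 * T_mul_Tinv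
    - (2 * (hF * sinhHXdivH) + T - Tinv) * two_mul_hF_mul_sinhHXdivH

lemma constantCoeff_sinhHXdivH : constantCoeff sinhHXdivH = Polynomial.X := by
  rw [← coeff_zero_eq_constantCoeff_apply, sinhHXdivH, coeff_mk]
  simp [Polynomial.X]

lemma constantCoeff_coshHX : constantCoeff coshHX = 1 := by
  have h := congrArg constantCoeff two_mul_coshHX
  rw [map_mul, map_add, map_ofNat, ← coeff_zero_eq_constantCoeff_apply T,
    ← coeff_zero_eq_constantCoeff_apply Tinv, T, Tinv, coeff_mk, coeff_mk] at h
  refine mul_left_cancel₀ (two_ne_zero (α := Polynomial ℂ)) (h.trans ?_)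
  norm_num [Polynomial.monomial_zero_one, one_add_one_eq_two]

lemma constantCoeff_dX (f : Fun) :
    constantCoeff (dX f) = Polynomial.derivative (constantCoeff f) := by
  rw [← coeff_zero_eq_constantCoeff_apply, coeff_dX, coeff_zero_eq_constantCoeff_apply]

/-! ### Commuting functions past the generators of `U_h(sl(2))` -/

lemma exists_eq_C_add_X_mul {A : Type*} [Ring A] (a : PowerSeries A) :
    ∃ (a₀ : A) (a' : PowerSeries A), a = C a₀ + X * a' := by
  refine ⟨constantCoeff a, PowerSeries.mk fun n => coeff (n + 1) a, ?_⟩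
  rw [add_comm]
  exact eq_X_mul_shift_add_const a

lemma toUh_eq_zero_iff (z : FreeSeries) :
    toUh z = 0 ↔ ∀ n : ℕ,
      z ∈ TwoSidedIdeal.span (relators ∪ {(PowerSeries.X : FreeSeries) ^ n}) := by
  rw [← TwoSidedIdeal.mem_iInf, ← closedIdeal, TwoSidedIdeal.mem_iff, ← RingCon.eq]
  rfl

lemma toUh_eq_zero_of_mem_relators {z : FreeSeries} (hz : z ∈ relators) : toUh z = 0 :=
  (toUh_eq_zero_iff z).2 fun _ => TwoSidedIdeal.subset_span (Or.inl hz)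

lemma op_hF : op hF = toUh PowerSeries.X := by
  rw [op, RingHom.comp_apply, funToFree, hF, PowerSeries.map_X]

lemma op_hF_mul_comm (z : Uh) : op hF * z = z * op hF := by
  obtain ⟨z, rfl⟩ := RingCon.mk'_surjective _ z
  change op hF * toUh z = toUh z * op hF
  rw [op_hF, ← map_mul, ← map_mul, X_mul]

/-- `U_h(sl(2))` is `h`-adically separated; this is where the closure of the ideal of relations
is used. -/
lemma eq_zero_of_forall_op_hF_pow_dvd {z : Uh} (hz : ∀ n : ℕ, op hF ^ n ∣ z) : z = 0 := by
  obtain ⟨z, rfl⟩ := RingCon.mk'_surjective _ z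
  change toUh z = 0
  rw [toUh_eq_zero_iff]
  intro n
  obtain ⟨y, hy⟩ := hz n
  obtain ⟨y, rfl⟩ := RingCon.mk'_surjective _ y
  change toUh z = op hF ^ n * toUh y at hy
  rw [op_hF, ← map_pow, ← map_mul, ← sub_eq_zero, ← map_sub, toUh_eq_zero_iff] at hy
  have h := TwoSidedIdeal.add_mem _ (hy n) (TwoSidedIdeal.mul_mem_right _ _ y
    (TwoSidedIdeal.subset_span (Or.inr rfl)))
  simpa using h

/-- By separatedness, an `h`-linear map from functions to `U_h(sl(2))` is determined by its values
on polynomials in `X`. -/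
lemma eq_zero_of_map_C_eq_zero (L : Fun →+ Uh) (hL : ∀ f, L (hF * f) = op hF * L f)
    (hC : ∀ p : Polynomial ℂ, L (C p) = 0) (f : Fun) : L f = 0 := by
  apply eq_zero_of_forall_op_hF_pow_dvd
  intro n
  induction n generalizing f with
  | zero => simp
  | succ n ih =>
    obtain ⟨p, g, rfl⟩ := exists_eq_C_add_X_mul f
    rw [← hF, map_add, hC, hL, zero_add, pow_succ']
    exact mul_dvd_mul_left _ (ih g)

lemma op_C_C_mul_comm (c : ℂ) (z : Uh) :
    op (C (Polynomial.C c)) * z = z * op (C (Polynomial.C c)) := by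
  obtain ⟨z, rfl⟩ := RingCon.mk'_surjective _ z
  change op _ * toUh z = toUh z * op _
  have h : funToFree (C (Polynomial.C c)) = C (algebraMap ℂ _ c) := by
    simp [funToFree]
  rw [op, RingHom.comp_apply, ← map_mul, ← map_mul, h]
  congr 1
  ext1 n
  rw [coeff_C_mul, coeff_mul_C, Algebra.commutes]

lemma funToFree_C_X : funToFree (C Polynomial.X) = gen Gen.X := by
  simp [funToFree, gen]

lemma H_mul_op_C_X : H * op (C Polynomial.X) = op (C Polynomial.X) * H + op (2 * sinhHXdivH) := by
  have h := toUh_eq_zero_of_mem_relators (z := gen .H * gen .X - gen .X * gen .H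
    - 2 * funToFree sinhHXdivH) (by simp [relators])
  rw [← funToFree_C_X, ← map_ofNat funToFree 2, ← map_mul funToFree] at h
  simp only [map_sub, map_mul toUh] at h
  exact sub_eq_iff_eq_add'.1 (sub_eq_zero.1 h)

lemma op_C_X_mul_Y : op (C Polynomial.X) * Y = Y * op (C Polynomial.X) + H := by
  have h := toUh_eq_zero_of_mem_relators (z := gen .X * gen .Y - gen .Y * gen .X - gen .H)
    (by simp [relators])
  rw [← funToFree_C_X] at h
  simp only [map_sub, map_mul toUh] at h
  exact sub_eq_iff_eq_add'.1 (sub_eq_zero.1 h)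

/-- The algebra structure over `ℕ` which agrees by unfolding with the `ℕ`-action of a module; the
tactic `module` needs to find this one rather than the one on power series. -/
instance : Algebra ℕ Fun := Semiring.toNatAlgebra

/-- As for `ℕ`, the algebra structure over `ℤ` which the tactic `module` needs to find. -/
instance : Algebra ℤ Fun := Ring.toIntAlgebra Fun

/-- `U_h(sl(2))` as a left module over the ring of functions. -/
instance : Module Fun Uh := Module.compHom Uh op

lemma smul_eq_op_mul (f : Fun) (z : Uh) : f • z = op f * z := rfl

instance : IsScalarTower Fun Uh Uh := ⟨fun f y z => mul_assoc (op f) y z⟩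

/-- `H_mul_smul` for polynomials, from the relation for `[H, X]` by the Leibniz rule. -/
lemma H_mul_C_smul (p : Polynomial ℂ) (z : Uh) :
    H * (C p • z : Uh) = (C p : Fun) • (H * z) + (2 * sinhHXdivH * dX (C p)) • z := by
  induction p using Polynomial.induction_on' generalizing z with
  | add p q hp hq =>
    rw [map_add C, add_smul, mul_add, hp, hq, map_add dX]
    module
  | monomial n a =>
    induction n generalizing z with
    | zero =>
      rw [Polynomial.monomial_zero_left, dX_C, Polynomial.derivative_C, smul_eq_op_mul,
        smul_eq_op_mul, ← mul_assoc, ← mul_assoc, op_C_C_mul_comm, map_zero]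
      simp
    | succ n ih =>
      rw [← Polynomial.monomial_mul_X, map_mul C, mul_smul, ih, dX_mul]
      have hX : H * ((C Polynomial.X : Fun) • z) = (C Polynomial.X : Fun) • (H * z)
          + (2 * sinhHXdivH * dX (C Polynomial.X)) • z := by
        rw [dX_C, Polynomial.derivative_X, map_one, mul_one]
        simp only [smul_eq_op_mul]
        rw [← mul_assoc, H_mul_op_C_X, add_mul, mul_assoc]
      rw [hX]
      module

/-- `[H, f] = (2/h) sinh(hX) ∂f/∂X` for every function `f`. -/
lemma H_mul_smul (f : Fun) (z : Uh) :
    H * (f • z) = f • (H * z) + (2 * sinhHXdivH * dX f) • z := by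
  let L : Fun →+ Uh := AddMonoidHom.mk'
    (fun f => H * (f • z) - (f • (H * z) + (2 * sinhHXdivH * dX f) • z))
    (fun f g => by simp only [map_add, mul_add, add_smul]; abel)
  refine sub_eq_zero.1 (eq_zero_of_map_C_eq_zero L (fun f => ?_) (fun p => ?_) f)
  · change H * ((hF * f) • z) - ((hF * f) • (H * z) + (2 * sinhHXdivH * dX (hF * f)) • z)
      = hF • (H * (f • z) - (f • (H * z) + (2 * sinhHXdivH * dX f) • z))
    have h : H * (hF • f • z) = hF • (H * (f • z)) := by
      rw [smul_eq_op_mul hF, smul_eq_op_mul hF, ← mul_assoc, ← op_hF_mul_comm, mul_assoc]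
    rw [mul_smul, h, dX_mul, dX_hF]
    module
  · exact sub_eq_zero.2 (H_mul_C_smul p z)

/-- `Y_mul_smul` for polynomials, from the relation for `[X, Y]` by the Leibniz rule. -/
lemma Y_mul_C_smul (p : Polynomial ℂ) (z : Uh) :
    Y * (C p • z : Uh) = (C p : Fun) • (Y * z) - dX (C p) • (H * z)
      - (sinhHXdivH * dX (dX (C p))) • z := by
  induction p using Polynomial.induction_on' generalizing z with
  | add p q hp hq =>
    rw [map_add C, add_smul, mul_add, hp, hq, map_add dX, map_add dX]
    module
  | monomial n a =>
    induction n generalizing z with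
    | zero =>
      rw [Polynomial.monomial_zero_left, dX_C, Polynomial.derivative_C, smul_eq_op_mul,
        smul_eq_op_mul, ← mul_assoc, ← mul_assoc, op_C_C_mul_comm, map_zero]
      simp
    | succ n ih =>
      rw [← Polynomial.monomial_mul_X, map_mul C, mul_smul, ih, dX_mul]
      have hX : Y * ((C Polynomial.X : Fun) • z) = (C Polynomial.X : Fun) • (Y * z) - H * z := by
        simp only [smul_eq_op_mul]
        rw [← mul_assoc, ← mul_assoc, op_C_X_mul_Y, add_mul, add_sub_cancel_right]
      have hX1 : dX (C Polynomial.X) = 1 := by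
        rw [dX_C, Polynomial.derivative_X, map_one]
      rw [hX, H_mul_smul, hX1]
      simp only [map_add, dX_mul, hX1, Derivation.map_one_eq_zero]
      module

/-- `[f, Y] = (∂f/∂X) H + (1/h) sinh(hX) ∂²f/∂X²` for every function `f`. -/
lemma Y_mul_smul (f : Fun) (z : Uh) :
    Y * (f • z) = f • (Y * z) - dX f • (H * z) - (sinhHXdivH * dX (dX f)) • z := by
  let L : Fun →+ Uh := AddMonoidHom.mk'
    (fun f => Y * (f • z) - (f • (Y * z) - dX f • (H * z) - (sinhHXdivH * dX (dX f)) • z))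
    (fun f g => by simp only [map_add, mul_add, add_smul]; abel)
  refine sub_eq_zero.1 (eq_zero_of_map_C_eq_zero L (fun f => ?_) (fun p => ?_) f)
  · change Y * ((hF * f) • z) - ((hF * f) • (Y * z) - dX (hF * f) • (H * z)
        - (sinhHXdivH * dX (dX (hF * f))) • z)
      = hF • (Y * (f • z) - (f • (Y * z) - dX f • (H * z) - (sinhHXdivH * dX (dX f)) • z))
    have h : Y * (hF • f • z) = hF • (Y * (f • z)) := by
      rw [smul_eq_op_mul hF, smul_eq_op_mul hF, ← mul_assoc, ← op_hF_mul_comm, mul_assoc]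
    rw [mul_smul, h, dX_mul, dX_hF, zero_mul, zero_add, dX_mul, dX_hF, zero_mul, zero_add]
    module
  · exact sub_eq_zero.2 (Y_mul_C_smul p z)

/-- The relation for `[H, Y]` with the functions of `X` moved to the left. -/
lemma H_mul_Y : H * Y = Y * H - (2 * coshHX) • Y + (hF ^ 2 * sinhHXdivH) • H
    + (hF ^ 2 * sinhHXdivH * coshHX) • (1 : Uh) := by
  have h := toUh_eq_zero_of_mem_relators (z := gen .H * gen .Y - gen .Y * gen .H
      - (-(gen .Y * funToFree coshHX) - funToFree coshHX * gen .Y)) (by simp [relators])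
  simp only [map_sub, map_mul toUh, map_neg] at h
  have h' : H * Y - Y * H - (-(Y * (coshHX • (1 : Uh))) - coshHX • Y) = 0 := by
    rw [smul_eq_op_mul, mul_one]; exact h
  rw [Y_mul_smul, dX_coshHX, dX_mul, dX_sinhHXdivH, pow_two, dX_mul, dX_hF, mul_one, mul_one] at h'
  rw [← sub_eq_zero, ← h']
  module

/-! ### The commutators of `J₊`, `J₀`, `J₋` in normal form -/

/-- The `sl(2)` relations for `J₊`, `J₀`, `J₋`, read off from the coefficients of `Y`, `1`, `H`,
`H²` with the functions of `X` on the left: first `[J₀, J₊] = 2J₊`, then the coefficients of `H` and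
`1` in `[J₊, J₋] = J₀`, then those of `Y`, `H²`, `H` and `1` in `[J₀, J₋] = -2J₋`. -/
def CoeffEqs (f₁ : Fun) (p : Coeffs) : Prop :=
  p.f₂ * sinhHXdivH * dX f₁ = f₁ ∧
  p.f₃ * dX f₁ - 4 * p.w * sinhHXdivH * dX f₁ = p.f₂ ∧
  p.f₃ * sinhHXdivH * dX (dX f₁) - 2 * p.v * sinhHXdivH * dX f₁
    - 2 * p.w * sinhHXdivH * dX (2 * sinhHXdivH * dX f₁) = 0 ∧
  2 * p.f₂ * sinhHXdivH * dX p.f₃ - 2 * coshHX * p.f₂ * p.f₃ = -2 * p.f₃ ∧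
  p.f₃ * dX p.f₂ + 2 * p.f₂ * sinhHXdivH * dX p.w - 4 * p.w * sinhHXdivH * dX p.f₂ = -2 * p.w ∧
  p.f₃ * sinhHXdivH * dX (dX p.f₂) + p.f₂ * p.f₃ * hF ^ 2 * sinhHXdivH
    + 2 * p.f₂ * sinhHXdivH * dX p.v - 2 * p.v * sinhHXdivH * dX p.f₂
    - 2 * p.w * sinhHXdivH * dX (2 * sinhHXdivH * dX p.f₂) = -2 * p.v ∧
  p.f₂ * p.f₃ * hF ^ 2 * sinhHXdivH * coshHX + 2 * p.f₂ * sinhHXdivH * dX p.u = -2 * p.u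

lemma comm_zero_plus (f₁ : Fun) (p : Coeffs) :
    Jzero p * Jplus f₁ - Jplus f₁ * Jzero p - 2 * Jplus f₁ =
      (2 * (p.f₂ * sinhHXdivH * dX f₁ - f₁)) • (1 : Uh) := by
  have hp : Jplus f₁ = f₁ • (1 : Uh) := (mul_one _).symm
  have h0 : Jzero p = p.f₂ • H := rfl
  rw [hp, h0, two_mul]
  simp only [smul_mul_assoc, H_mul_smul, one_mul, mul_one]
  module

lemma Jminus_eq (p : Coeffs) :
    Jminus p = p.f₃ • Y + p.u • (1 : Uh) + p.v • H + p.w • (H * H) := by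
  simp only [smul_eq_op_mul, mul_one, Jminus, pow_two]

lemma comm_plus_minus (f₁ : Fun) (p : Coeffs) :
    Jplus f₁ * Jminus p - Jminus p * Jplus f₁ - Jzero p =
      (0 : Fun) • Y +
      (p.f₃ * sinhHXdivH * dX (dX f₁) - 2 * p.v * sinhHXdivH * dX f₁
        - 2 * p.w * sinhHXdivH * dX (2 * sinhHXdivH * dX f₁)) • (1 : Uh) +
      (p.f₃ * dX f₁ - 4 * p.w * sinhHXdivH * dX f₁ - p.f₂) • H + (0 : Fun) • (H * H) := by
  have hp : Jplus f₁ = f₁ • (1 : Uh) := (mul_one _).symm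
  have h0 : Jzero p = p.f₂ • H := rfl
  rw [hp, h0, Jminus_eq]
  simp only [smul_mul_assoc, add_mul, mul_add, mul_assoc, H_mul_smul, Y_mul_smul, one_mul, mul_one,
    smul_add, smul_sub]
  module

lemma comm_zero_minus (p : Coeffs) :
    Jzero p * Jminus p - Jminus p * Jzero p + 2 * Jminus p =
      (2 * p.f₂ * sinhHXdivH * dX p.f₃ - 2 * coshHX * p.f₂ * p.f₃ + 2 * p.f₃) • Y +
      (p.f₂ * p.f₃ * hF ^ 2 * sinhHXdivH * coshHX + 2 * p.f₂ * sinhHXdivH * dX p.u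
        + 2 * p.u) • (1 : Uh) +
      (p.f₃ * sinhHXdivH * dX (dX p.f₂) + p.f₂ * p.f₃ * hF ^ 2 * sinhHXdivH
        + 2 * p.f₂ * sinhHXdivH * dX p.v - 2 * p.v * sinhHXdivH * dX p.f₂
        - 2 * p.w * sinhHXdivH * dX (2 * sinhHXdivH * dX p.f₂) + 2 * p.v) • H +
      (p.f₃ * dX p.f₂ + 2 * p.f₂ * sinhHXdivH * dX p.w - 4 * p.w * sinhHXdivH * dX p.f₂
        + 2 * p.w) • (H * H) := by
  have h0 : Jzero p = p.f₂ • H := rfl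
  rw [h0, Jminus_eq, two_mul]
  simp only [smul_mul_assoc, add_mul, mul_add, mul_assoc, H_mul_smul, Y_mul_smul, one_mul, mul_one,
    smul_add, smul_sub, H_mul_Y]
  module

/-! ### Extending homomorphisms to power series -/

section ExtendSeries

variable {A B : Type*} [Ring A] [Ring B] (φ : A →+* PowerSeries B)

/-- The value `∑ₙ hⁿ φ(aₙ)` of the `h`-adically continuous extension of `φ : A → B⟦h⟧` at the series
`∑ₙ hⁿ aₙ`. -/
def extendFun (a : PowerSeries A) : PowerSeries B :=
  PowerSeries.mk fun n =>
    ∑ ij ∈ Finset.HasAntidiagonal.antidiagonal n, coeff ij.2 (φ (coeff ij.1 a))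

lemma extendFun_add (a b : PowerSeries A) :
    extendFun φ (a + b) = extendFun φ a + extendFun φ b := by
  ext n
  simp [extendFun, Finset.sum_add_distrib]

lemma extendFun_X_mul (a : PowerSeries A) : extendFun φ (X * a) = X * extendFun φ a := by
  ext n
  cases n with
  | zero => simp [extendFun]
  | succ n =>
    rw [coeff_succ_X_mul, extendFun, extendFun, coeff_mk, coeff_mk,
      Finset.Nat.sum_antidiagonal_succ]
    simp [coeff_succ_X_mul]

lemma extendFun_C (a : A) : extendFun φ (C a) = φ a := by
  ext n
  rw [extendFun, coeff_mk, Finset.sum_eq_single (0, n)]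
  · simp
  · rintro ⟨i, j⟩ hij hne
    have hi : i ≠ 0 := by
      rintro rfl
      exact hne (by rw [← Finset.HasAntidiagonal.mem_antidiagonal.1 hij, zero_add])
    rw [coeff_C, if_neg hi, map_zero, map_zero]
  · simp

lemma extendFun_C_mul (a : A) (b : PowerSeries A) :
    extendFun φ (C a * b) = φ a * extendFun φ b := by
  have h (b₀ : A) (b' : PowerSeries A) :
      extendFun φ (C a * (C b₀ + X * b')) = φ a * φ b₀ + X * extendFun φ (C a * b') := by
    rw [mul_add, ← map_mul C, ← mul_assoc, ← X_mul, mul_assoc, extendFun_add, extendFun_C,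
      extendFun_X_mul, map_mul]
  have h' (b₀ : A) (b' : PowerSeries A) :
      φ a * extendFun φ (C b₀ + X * b') = φ a * φ b₀ + X * (φ a * extendFun φ b') := by
    rw [extendFun_add, extendFun_C, extendFun_X_mul, mul_add, ← mul_assoc, ← X_mul, mul_assoc]
  ext n
  induction n generalizing b with
  | zero =>
    obtain ⟨b₀, b', rfl⟩ := exists_eq_C_add_X_mul b
    rw [h, h', map_add, map_add, coeff_zero_X_mul, coeff_zero_X_mul]
  | succ n ih =>
    obtain ⟨b₀, b', rfl⟩ := exists_eq_C_add_X_mul b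
    rw [h, h', map_add, map_add, coeff_succ_X_mul, coeff_succ_X_mul, ih]

/-- Writing `a = a₀ + h a'` turns both sides into `φ(a₀) Φ(b)` plus `h` times the same expression for
`a'`, where `Φ` is the extension, so they agree coefficient by coefficient. -/
lemma extendFun_mul (a b : PowerSeries A) :
    extendFun φ (a * b) = extendFun φ a * extendFun φ b := by
  ext n
  induction n generalizing a with
  | zero =>
    obtain ⟨a₀, a', rfl⟩ := exists_eq_C_add_X_mul a
    simp only [add_mul, extendFun_add, mul_assoc, extendFun_C_mul, extendFun_X_mul, extendFun_C,
      map_add, coeff_zero_X_mul]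
  | succ n ih =>
    obtain ⟨a₀, a', rfl⟩ := exists_eq_C_add_X_mul a
    simp only [add_mul, extendFun_add, mul_assoc, extendFun_C_mul, extendFun_X_mul, extendFun_C,
      map_add, coeff_succ_X_mul, ih]

/-- The `h`-adically continuous extension `A⟦h⟧ → B⟦h⟧` of a ring homomorphism `A → B⟦h⟧`. -/
def extendSeries : PowerSeries A →+* PowerSeries B where
  toFun := extendFun φ
  map_one' := by rw [← map_one C, extendFun_C, map_one]
  map_zero' := by rw [← map_zero C, extendFun_C, map_zero]
  map_mul' := extendFun_mul φ
  map_add' := extendFun_add φ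

lemma extendSeries_C (a : A) : extendSeries φ (C a) = φ a := extendFun_C φ a

lemma extendSeries_X : extendSeries φ X = X := by
  have h := extendFun_X_mul φ 1
  rw [mul_one] at h
  exact h.trans (by rw [← map_one C, extendFun_C, map_one, mul_one])

lemma extendSeries_map {A' : Type*} [Ring A'] (g : A' →+* A) (g' : A' →+* B)
    (h : ∀ a, φ (g a) = C (g' a)) (f : PowerSeries A') :
    extendSeries φ (PowerSeries.map g f) = PowerSeries.map g' f := by
  ext n
  change coeff n (extendFun φ _) = _
  rw [extendFun, coeff_mk, Finset.sum_eq_single (n, 0)]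
  · simp [h]
  · rintro ⟨i, j⟩ hij hne
    have hj : j ≠ 0 := by
      rintro rfl
      exact hne (by rw [← Finset.HasAntidiagonal.mem_antidiagonal.1 hij, add_zero])
    rw [coeff_map, h, coeff_C, if_neg hj]
  · simp

end ExtendSeries

/-! ### A representation by differential operators -/

/-- The ring `End(ℂ[X])⟦h⟧`, in which the differential operators in `X` with coefficients in
`ℂ[X]⟦h⟧` live. -/
abbrev Ops : Type := PowerSeries (Module.End ℂ (Polynomial ℂ))

/-- A function, as the operator of multiplication by it. -/
def mulOp : Fun →+* Ops := PowerSeries.map (Algebra.lmul ℂ (Polynomial ℂ)).toRingHom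

/-- The operator `∂/∂X`. -/
def dOp : Ops := C Polynomial.derivative

instance : Module Fun Ops := Module.compHom Ops mulOp

lemma smul_eq_mulOp_mul (f : Fun) (z : Ops) : f • z = mulOp f * z := rfl

instance : IsScalarTower Fun Ops Ops := ⟨fun f y z => mul_assoc (mulOp f) y z⟩

lemma coeff_mulOp (f : Fun) (n : ℕ) : coeff n (mulOp f) = Algebra.lmul ℂ _ (coeff n f) := rfl

lemma dOp_mul_smul (f : Fun) (z : Ops) : dOp * (f • z) = f • (dOp * z) + dX f • z := by
  simp only [smul_eq_mulOp_mul, ← mul_assoc, ← add_mul]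
  congr 1
  ext1 n
  apply LinearMap.ext
  intro q
  rw [dOp, coeff_C_mul, map_add, coeff_mul_C, coeff_mulOp, coeff_mulOp, coeff_dX]
  simp [add_comm]

/-- Differential operators of order at most two have unique coefficients. -/
lemma ops_eq_zero {a b c : Fun} (h : a • (dOp * dOp) + b • dOp + c • (1 : Ops) = 0) :
    a = 0 ∧ b = 0 ∧ c = 0 := by
  have key (n : ℕ) (q : Polynomial ℂ) :
      coeff n a * Polynomial.derivative (Polynomial.derivative q) +
        coeff n b * Polynomial.derivative q + coeff n c * q = 0 := by
    have h1 := LinearMap.congr_fun (congrArg (coeff n) h) q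
    rw [smul_eq_mulOp_mul, smul_eq_mulOp_mul, smul_eq_mulOp_mul, mul_one, dOp, ← map_mul C,
      map_add, map_add, coeff_mul_C, coeff_mul_C, coeff_mulOp, coeff_mulOp, coeff_mulOp] at h1
    simpa using h1
  have hc : c = 0 := by
    ext1 n
    simpa using key n 1
  have hb : b = 0 := by
    ext1 n
    simpa [hc] using key n Polynomial.X
  refine ⟨?_, hb, hc⟩
  ext1 n
  have h2 := key n (Polynomial.X ^ 2)
  simpa [hc, hb, Polynomial.derivative_pow] using h2

/-- The operator `s ∂ + (2k + 1) cosh hX`, where `s = (2/h) sinh hX`, by which `H` acts in the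
representation with parameter `k`. -/
def HOp (k : Fun) : Ops := (2 * sinhHXdivH) • dOp + ((2 * k + 1) * coshHX) • (1 : Ops)

/-- The operator by which `Y` acts in the representation with parameter `k`. Its coefficients are
dictated by `[X, Y] = H` and `[H, Y] = -Y cosh hX - cosh hX Y`; the weight is written `2k + 1` so
that `(1 - (2k + 1)²) / 4 = -k (k + 1)` needs no denominator. -/
def YOp (k : Fun) : Ops := (-sinhHXdivH) • (dOp * dOp) + (-((2 * k + 1) * coshHX)) • dOp
  + (-(k * (k + 1) * hF ^ 2 * sinhHXdivH)) • (1 : Ops)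

/-- The action of the generators by differential operators. -/
def genOp (k : Fun) : Gen → Ops
  | .X => mulOp (C Polynomial.X)
  | .Y => YOp k
  | .H => HOp k

/-- The action of the completed free algebra by differential operators. -/
def freeRep (k : Fun) : FreeSeries →+* Ops :=
  extendSeries (FreeAlgebra.lift ℂ (genOp k)).toRingHom

lemma freeRep_gen (k : Fun) (g : Gen) : freeRep k (gen g) = genOp k g := by
  rw [freeRep, gen, extendSeries_C]
  exact FreeAlgebra.lift_ι_apply _ _

lemma freeRep_funToFree (k : Fun) (f : Fun) : freeRep k (funToFree f) = mulOp f := by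
  rw [freeRep, funToFree, mulOp]
  refine extendSeries_map _ _ _ (fun p => ?_) f
  have h : ((FreeAlgebra.lift ℂ (genOp k)).toRingHom.comp
      (Polynomial.aeval (R := ℂ) (FreeAlgebra.ι ℂ Gen.X)).toRingHom) =
      (C : _ →+* Ops).comp (Algebra.lmul ℂ (Polynomial ℂ)).toRingHom := by
    apply Polynomial.ringHom_ext
    · intro a
      have ha : algebraMap ℂ (Module.End ℂ (Polynomial ℂ)) a =
          Algebra.lmul ℂ (Polynomial ℂ) (Polynomial.C a) := by
        apply LinearMap.ext
        intro q
        simp [Polynomial.smul_eq_C_mul]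
      simpa [PowerSeries.algebraMap_apply] using congrArg (C : _ →+* Ops) ha
    · simp [genOp, mulOp]
  exact RingHom.congr_fun h p

lemma freeRep_relators (k : Fun) (hk : dX k = 0) {z : FreeSeries} (hz : z ∈ relators) :
    freeRep k z = 0 := by
  have hm (f : Fun) : mulOp f = f • (1 : Ops) := (mul_one _).symm
  have hX1 : dX (C Polynomial.X) = 1 := by rw [dX_C, Polynomial.derivative_X, map_one]
  have h2 (z : Ops) : (2 : Ops) * z = (2 : Fun) • z := by
    rw [smul_eq_mulOp_mul, map_ofNat]
  rcases hz with rfl | rfl | rfl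
  · simp only [map_sub, map_mul, map_ofNat, freeRep_gen, freeRep_funToFree, genOp, HOp, hm, h2,
      add_mul, mul_add, smul_mul_assoc, mul_assoc, one_mul, mul_one, dOp_mul_smul, hX1]
    module
  · simp only [map_sub, map_mul (freeRep k), map_neg, freeRep_gen,
      freeRep_funToFree, genOp, HOp, YOp, hm,
      add_mul, mul_add, smul_mul_assoc, mul_assoc, one_mul,
      mul_one, dOp_mul_smul, smul_add, dX_mul, dX_ofNat, dX_coshHX, dX_sinhHXdivH, map_add, hk,
      dX_hF, pow_two, map_zero]
    module
  · simp only [map_sub, map_mul, freeRep_gen, genOp, HOp, YOp, hm,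
      add_mul, mul_add, smul_mul_assoc, mul_assoc, one_mul,
      mul_one, dOp_mul_smul, smul_add, hX1, Derivation.map_one_eq_zero]
    module

lemma freeRep_eq_zero (k : Fun) (hk : dX k = 0) {z : FreeSeries} (hz : z ∈ closedIdeal) :
    freeRep k z = 0 := by
  have hdvd (n : ℕ) : X ^ n ∣ freeRep k z := by
    let J : TwoSidedIdeal FreeSeries := TwoSidedIdeal.mk' {z | X ^ n ∣ freeRep k z}
      (by simp) (fun {x y} hx hy => by simpa using dvd_add hx hy) (fun {x} hx => by
        have : X ^ n ∣ freeRep k x := hx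
        obtain ⟨w, hw⟩ := this
        refine ⟨freeRep k (-1) * w, ?_⟩
        rw [← neg_one_mul, map_mul, hw, ← mul_assoc, ← mul_assoc, X_pow_mul])
      (fun {x y} hy => by
        obtain ⟨w, hw⟩ := hy
        refine ⟨freeRep k x * w, ?_⟩
        rw [map_mul, hw, ← mul_assoc, ← mul_assoc, X_pow_mul])
      (fun {x y} hx => by
        have : X ^ n ∣ freeRep k x := hx
        simpa using this.mul_right _)
    have hle : TwoSidedIdeal.span (relators ∪ {(X : FreeSeries) ^ n}) ≤ J := by
      rw [TwoSidedIdeal.span_le]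
      rintro y (hy | rfl)
      · refine (TwoSidedIdeal.mem_mk' _ _ _ _ _ _ _).2 ?_
        change X ^ n ∣ freeRep k y
        rw [freeRep_relators k hk hy]
        exact dvd_zero _
      · refine (TwoSidedIdeal.mem_mk' _ _ _ _ _ _ _).2 ?_
        change X ^ n ∣ freeRep k (X ^ n)
        rw [map_pow, freeRep, extendSeries_X]
    have hz' : z ∈ J := hle ((TwoSidedIdeal.mem_iInf _).1 hz n)
    exact (TwoSidedIdeal.mem_mk' {z | X ^ n ∣ freeRep k z} _ _ _ _ _ z).1 hz'
  ext1 n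
  exact X_pow_dvd_iff.1 (hdvd (n + 1)) n n.lt_succ_self

/-- The representation of `U_h(sl(2))` by differential operators in `X`, with a parameter `k`
constant in `X`. -/
def rep (k : Fun) (hk : dX k = 0) : Uh →+* Ops :=
  closedIdeal.ringCon.lift (freeRep k) fun x y hxy => by
    rw [RingCon.ker_apply, ← sub_eq_zero, ← map_sub]
    exact freeRep_eq_zero k hk ((TwoSidedIdeal.rel_iff _ _ _).1 hxy)

lemma rep_smul (k : Fun) (hk : dX k = 0) (f : Fun) (z : Uh) :
    rep k hk (f • z) = f • rep k hk z := by
  rw [smul_eq_op_mul, map_mul, smul_eq_mulOp_mul]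
  congr 1
  exact freeRep_funToFree k f

lemma rep_H (k : Fun) (hk : dX k = 0) : rep k hk H = HOp k := freeRep_gen k .H

lemma rep_Y (k : Fun) (hk : dX k = 0) : rep k hk Y = YOp k := freeRep_gen k .Y

lemma sinhHXdivH_ne_zero : sinhHXdivH ≠ 0 := by
  intro h
  have h1 := constantCoeff_sinhHXdivH
  rw [h, map_zero] at h1
  exact Polynomial.X_ne_zero h1.symm

/-- The coefficients of `∂²`, `∂` and `1` in the image of a vanishing combination of `Y, 1, H, H²`
under the representation with parameter `k`. -/
lemma rep_normalForm {a b c e : Fun}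
    (h : a • Y + b • (1 : Uh) + c • H + e • (H * H) = 0) (k : Fun) (hk : dX k = 0) :
    4 * e * sinhHXdivH ^ 2 - a * sinhHXdivH = 0 ∧
    2 * c * sinhHXdivH + e * (4 * sinhHXdivH * coshHX
      + 4 * (2 * k + 1) * sinhHXdivH * coshHX) - a * (2 * k + 1) * coshHX = 0 ∧
    b + c * (2 * k + 1) * coshHX + e * ((2 * k + 1) ^ 2 * coshHX ^ 2
      + 2 * (2 * k + 1) * hF ^ 2 * sinhHXdivH ^ 2) - a * k * (k + 1) * hF ^ 2 * sinhHXdivH = 0 := by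
  apply ops_eq_zero
  rw [← map_zero (rep k hk), ← h]
  simp only [map_add, map_mul, rep_smul, rep_H, rep_Y, map_one, HOp, YOp,
      add_mul, mul_add, smul_mul_assoc, mul_assoc, one_mul,
      mul_one, dOp_mul_smul, smul_add, dX_mul, dX_ofNat, dX_coshHX, dX_sinhHXdivH, hk]
  module

/-- The part of the Poincaré–Birkhoff–Witt theorem which is needed: `Y, 1, H, H²` are linearly
independent over the functions of `X`. The representation with a single `k` does not show
this, because some nonzero combination acts by zero in it; three values of `k` suffice. -/
lemma normalForm_eq_zero {a b c e : Fun}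
    (h : a • Y + b • (1 : Uh) + c • H + e • (H * H) = 0) :
    a = 0 ∧ b = 0 ∧ c = 0 ∧ e = 0 := by
  obtain ⟨h1, h2, h3⟩ := rep_normalForm h 0 (map_zero _)
  obtain ⟨-, -, h4⟩ := rep_normalForm h 1 dX.map_one_eq_zero
  obtain ⟨-, -, h5⟩ := rep_normalForm h (-1) (by rw [map_neg, dX.map_one_eq_zero, neg_zero])
  have ha : 4 * e * sinhHXdivH - a = 0 := by
    refine (mul_eq_zero.1 ?_).resolve_right sinhHXdivH_ne_zero
    linear_combination h1
  -- The second difference in `k` of the constant terms isolates `8 e`.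
  have he : e = 0 := by
    refine (mul_eq_zero.1 (?_ : (8 : Fun) * e = 0)).resolve_left (OfNat.ofNat_ne_zero 8)
    linear_combination h4 + h5 - 2 * h3 - 8 * e * coshHX_sq - 2 * hF ^ 2 * sinhHXdivH * ha
  have ha : a = 0 := by linear_combination 4 * sinhHXdivH * he - ha
  have hc : c = 0 := by
    refine (mul_eq_zero.1 (?_ : (2 * sinhHXdivH) * c = 0)).resolve_left
      (mul_ne_zero two_ne_zero sinhHXdivH_ne_zero)
    rw [he, ha] at h2
    linear_combination h2
  refine ⟨ha, ?_, hc, he⟩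
  rw [he, ha, hc] at h3
  linear_combination h3

/-! ### The relations as equations between functions -/

lemma satisfiesSl2_iff_coeffEqs (f₁ : Fun) (p : Coeffs) :
    SatisfiesSl2 (Jplus f₁) (Jzero p) (Jminus p) ↔ CoeffEqs f₁ p := by
  have e1 : Jzero p * Jplus f₁ - Jplus f₁ * Jzero p = 2 * Jplus f₁ ↔
      p.f₂ * sinhHXdivH * dX f₁ = f₁ := by
    rw [← sub_eq_zero, comm_zero_plus]
    constructor
    · intro h
      obtain ⟨-, h, -, -⟩ := normalForm_eq_zero (a := 0) (c := 0) (e := 0)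
        (by rw [h]; simp)
      exact sub_eq_zero.1 ((mul_eq_zero.1 h).resolve_left two_ne_zero)
    · intro h
      rw [h, sub_self, mul_zero, zero_smul]
  have e2 := comm_zero_minus p
  have e3 := comm_plus_minus f₁ p
  rw [SatisfiesSl2, CoeffEqs, e1, ← sub_eq_zero (b := -(2 * Jminus p)), sub_neg_eq_add, e2,
    ← sub_eq_zero (b := Jzero p), e3]
  constructor
  · rintro ⟨h1, h2, h3⟩
    obtain ⟨a1, a2, a3, a4⟩ := normalForm_eq_zero h2
    obtain ⟨-, b2, b3, -⟩ := normalForm_eq_zero h3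
    exact ⟨h1, by linear_combination b3, b2, by linear_combination a1, by linear_combination a4,
      by linear_combination a3, by linear_combination a2⟩
  · rintro ⟨h1, h2, h3, h4, h5, h6, h7⟩
    refine ⟨h1, ?_, ?_⟩
    · rw [h4, h5, h6, h7]
      module
    · rw [h2, h3]
      module

/-- The explicit expressions for `f₂, f₃, u, v, w` with denominators cleared, as identities between
functions; `T - T⁻¹` is written as `2 sinh hX` and `T + T⁻¹` as `2 cosh hX`. -/
def ClearedSolution (f₁ : Fun) (p : Coeffs) : Prop :=
  p.f₂ * sinhHXdivH * dX f₁ = f₁ ∧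
  f₁ * p.f₃ = sinhHXdivH ∧
  4 * f₁ * p.u = -(hF ^ 2 * sinhHXdivH ^ 2) ∧
  2 * p.v * f₁ * dX f₁ = -(dX p.f₂ * f₁ - p.f₂ * dX f₁ + coshHX * dX f₁) ∧
  4 * p.w * f₁ = 1 - p.f₂ ^ 2

section

variable {f₁ : Fun} {p : Coeffs}

/-- The derivative of `f₂ (sinh hX / h) ∂f₁ = f₁`. -/
lemma dX_f₂_eq (h1 : p.f₂ * sinhHXdivH * dX f₁ = f₁) :
    dX p.f₂ * sinhHXdivH * dX f₁ + p.f₂ * (coshHX * dX f₁ + sinhHXdivH * dX (dX f₁)) = dX f₁ := by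
  have h := congrArg dX h1
  rw [dX_mul, dX_mul, dX_sinhHXdivH] at h
  linear_combination h

/-- The relations force the explicit expressions. Two of the equations are first order differential
equations, for `w` and for `u`; their constants of integration in `ℂ⟦h⟧` are determined at `X = 0`,
where `f₁` and `sinh hX` vanish and `f₂` takes the value `1`. -/
lemma CoeffEqs.clearedSolution (hF' : evalOne (dX f₁) ≠ 0) (h : CoeffEqs f₁ p) :
    ClearedSolution f₁ p := by
  obtain ⟨h1, h2, h3, -, h5, -, h7⟩ := h
  have hd0 : dX f₁ ≠ 0 := fun h => hF' (by rw [h, map_zero])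
  have hA := dX_f₂_eq h1
  have ev : evalOne p.f₂ = 1 := by
    have h := congrArg evalOne hA
    simp only [map_add, map_mul, evalOne_sinhHXdivH, evalOne_coshHX] at h
    refine mul_right_cancel₀ hF' ?_
    linear_combination h
  have ev1 : evalOne f₁ = 0 := by
    rw [← h1, map_mul, map_mul, evalOne_sinhHXdivH, mul_zero, zero_mul]
  have hw : 4 * p.w * f₁ = 1 - p.f₂ ^ 2 := by
    rw [← sub_eq_zero]
    apply eq_zero_of_dX_eq_zero
    · simp only [map_sub, dX_mul, dX_ofNat, pow_two, Derivation.map_one_eq_zero]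
      linear_combination 2 * dX f₁ * h5 - 2 * dX p.f₂ * h2 - 4 * dX p.w * h1
    · simp only [map_sub, map_mul, map_pow, map_one, ev, ev1]
      ring
  have h3' : f₁ * p.f₃ = sinhHXdivH := by
    refine mul_right_cancel₀ hd0 ?_
    linear_combination f₁ * h2 + sinhHXdivH * dX f₁ * hw - p.f₂ * h1
  have hu : 4 * f₁ * p.u = -(hF ^ 2 * sinhHXdivH ^ 2) := by
    rw [← sub_eq_zero]
    apply eq_zero_of_dX_eq_zero
    · simp only [map_sub, map_neg, dX_mul, dX_ofNat, pow_two, dX_hF, dX_sinhHXdivH]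
      linear_combination 2 * dX f₁ * h7 - 2 * (p.f₃ * hF ^ 2 * coshHX + 2 * dX p.u) * h1
        - 2 * hF ^ 2 * coshHX * h3'
    · simp only [map_sub, map_neg, map_mul, map_pow, evalOne_sinhHXdivH, ev1]
      ring
  refine ⟨h1, h3', hu, ?_, hw⟩
  refine mul_right_cancel₀ sinhHXdivH_ne_zero ?_
  simp only [dX_mul, dX_ofNat, dX_sinhHXdivH] at h3
  linear_combination -f₁ * h3 + sinhHXdivH * dX (dX f₁) * h3'
    - sinhHXdivH * (coshHX * dX f₁ + sinhHXdivH * dX (dX f₁)) * hw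
    + sinhHXdivH * p.f₂ * hA - sinhHXdivH * dX p.f₂ * h1

lemma ClearedSolution.coeffEqs (h0 : f₁ ≠ 0) (hd0 : dX f₁ ≠ 0) (h : ClearedSolution f₁ p) :
    CoeffEqs f₁ p := by
  obtain ⟨h1, hf₃, hu, hv, hw⟩ := h
  have hA := dX_f₂_eq h1
  have dF₃ : dX f₁ * p.f₃ + f₁ * dX p.f₃ = coshHX := by
    rw [← dX_mul, hf₃, dX_sinhHXdivH]
  have dU : 4 * (dX f₁ * p.u + f₁ * dX p.u) = -(2 * hF ^ 2 * sinhHXdivH * coshHX) := by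
    have h := congrArg dX hu
    simp only [map_neg, dX_mul, dX_ofNat, pow_two, dX_hF, dX_sinhHXdivH] at h
    linear_combination h
  have dW : 4 * (dX p.w * f₁ + p.w * dX f₁) = -(2 * p.f₂ * dX p.f₂) := by
    have h := congrArg dX hw
    simp only [map_sub, dX_mul, dX_ofNat, pow_two, Derivation.map_one_eq_zero] at h
    linear_combination h
  have dV : 2 * (dX p.v * f₁ * dX f₁ + p.v * dX f₁ ^ 2 + p.v * f₁ * dX (dX f₁)) =
      -(dX (dX p.f₂) * f₁ - p.f₂ * dX (dX f₁) + hF ^ 2 * sinhHXdivH * dX f₁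
        + coshHX * dX (dX f₁)) := by
    have h := congrArg dX hv
    simp only [map_neg, map_sub, map_add, dX_mul, dX_ofNat, dX_coshHX] at h
    linear_combination h
  have e2 : p.f₃ * dX f₁ - 4 * p.w * sinhHXdivH * dX f₁ = p.f₂ := by
    refine mul_right_cancel₀ h0 ?_
    linear_combination dX f₁ * hf₃ - sinhHXdivH * dX f₁ * hw + p.f₂ * h1
  -- Each remaining equation becomes an identity after multiplication by powers of `f₁` and `∂f₁`.
  refine ⟨h1, e2, ?_, ?_, ?_, ?_, ?_⟩
  · refine mul_right_cancel₀ h0 ?_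
    simp only [dX_mul, dX_ofNat, dX_sinhHXdivH]
    linear_combination sinhHXdivH * dX (dX f₁) * hf₃ - sinhHXdivH * hv
      - sinhHXdivH * (coshHX * dX f₁ + sinhHXdivH * dX (dX f₁)) * hw
      + sinhHXdivH * p.f₂ * hA - sinhHXdivH * dX p.f₂ * h1
  · refine mul_right_cancel₀ (mul_ne_zero h0 hd0) ?_
    linear_combination 2 * f₁ * dX p.f₃ * h1 + 2 * f₁ * dF₃ - 2 * coshHX * p.f₂ * dX f₁ * hf₃
      - 2 * coshHX * h1
  · refine mul_right_cancel₀ hd0 ?_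
    refine mul_left_cancel₀ (two_ne_zero (α := Fun)) ?_
    linear_combination 2 * dX p.f₂ * e2 + 4 * dX p.w * h1 + dW
  · refine mul_right_cancel₀ (mul_ne_zero hd0 (mul_ne_zero hd0 h0)) ?_
    simp only [dX_mul, dX_ofNat, dX_sinhHXdivH]
    have r2 : f₁ * dX (dX f₁) + dX f₁ * (sinhHXdivH * dX f₁ * dX p.f₂)
        = dX f₁ ^ 2 * (1 - p.f₂ * coshHX) := by
      linear_combination dX f₁ * hA - dX (dX f₁) * h1
    linear_combination (sinhHXdivH * dX (dX p.f₂) * e2 + (hF ^ 2 * p.f₃ + 2 * dX p.v) * h1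
      + hF ^ 2 * hf₃) * dX f₁ * f₁ + (dX (dX p.f₂) * h1 + dV) * f₁
      + (p.f₂ - coshHX) * r2 - 2 * p.v * f₁ * r2
      - dX f₁ * (1 - p.f₂ * coshHX) * hv
      - coshHX * dX f₁ * (sinhHXdivH * dX f₁ * dX p.f₂) * hw
      - dX p.f₂ * dX f₁ * (1 - p.f₂ * coshHX) * h1
  · refine mul_right_cancel₀ hd0 ?_
    refine mul_left_cancel₀ (two_ne_zero (α := Fun)) ?_
    linear_combination (2 * p.f₃ * hF ^ 2 * coshHX + 4 * dX p.u) * h1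
      + 2 * hF ^ 2 * coshHX * hf₃ + dU

end

/-! ### The explicit solution -/

lemma hF_ne_zero : hF ≠ 0 := PowerSeries.X_ne_zero

lemma frac_injective : Function.Injective frac := IsFractionRing.injective Fun K

/-- The explicit expressions in a field, with denominators cleared. Here `S` stands for
`sinh (hX) / h`, `c` for `cosh (hX)` and `dF`, `d₂` for the `X`-derivatives of `F = f₁` and of `f₂`. -/
lemma field_solution_iff {L : Type*} [Field L] [CharZero L] {t h S c F dF f₂ d₂ f₃ u v w : L}
    (ht : t ≠ 0) (hh : h ≠ 0) (hS : S ≠ 0) (hF0 : F ≠ 0) (hdF : dF ≠ 0)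
    (hTS : 2 * (h * S) = t - t⁻¹) (hTc : 2 * c = t + t⁻¹) :
    (f₂ = 2 / (t ^ 2 - 1) * (F / (dF / (h * t))) ↔ f₂ * S * dF = F) ∧
    (f₃ = 1 / (2 * h) * ((t - t⁻¹) / F) ↔ F * f₃ = S) ∧
    (u = -((t - t⁻¹) ^ 2 / (16 * F)) ↔ 4 * F * u = -(h ^ 2 * S ^ 2)) ∧
    (v = -(1 / 2) * (d₂ / (h * t) / (dF / (h * t)) - f₂ / F + (t + t⁻¹) / (2 * F)) ↔
      2 * v * F * dF = -(d₂ * F - f₂ * dF + c * dF)) ∧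
    (w = 1 / (4 * F) * (1 - f₂ ^ 2) ↔ 4 * w * F = 1 - f₂ ^ 2) := by
  have ht2 : t ^ 2 - 1 = t * (2 * (h * S)) := by rw [hTS]; field_simp
  refine ⟨?_, ?_, ?_, ?_, ?_⟩
  · rw [ht2, show 2 / (t * (2 * (h * S))) * (F / (dF / (h * t))) = F / (S * dF) by field_simp,
      eq_div_iff (mul_ne_zero hS hdF), mul_assoc]
  · rw [← hTS, show 1 / (2 * h) * (2 * (h * S) / F) = S / F by field_simp, eq_div_iff hF0, mul_comm]
  · rw [← hTS, show -((2 * (h * S)) ^ 2 / (16 * F)) = -(h ^ 2 * S ^ 2) / (4 * F) by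
      field_simp; norm_num, eq_div_iff (mul_ne_zero (OfNat.ofNat_ne_zero 4) hF0), mul_comm]
  · rw [← hTc, show -(1 / 2) * (d₂ / (h * t) / (dF / (h * t)) - f₂ / F + 2 * c / (2 * F)) =
      -(d₂ * F - f₂ * dF + c * dF) / (2 * F * dF) by field_simp,
      eq_div_iff (mul_ne_zero (mul_ne_zero two_ne_zero hF0) hdF),
      show v * (2 * F * dF) = 2 * v * F * dF by ring]
  · rw [show 1 / (4 * F) * (1 - f₂ ^ 2) = (1 - f₂ ^ 2) / (4 * F) by field_simp,
      eq_div_iff (mul_ne_zero (OfNat.ofNat_ne_zero 4) hF0), show w * (4 * F) = 4 * w * F by ring]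

instance : CharZero K := charZero_of_injective_ringHom frac_injective

lemma isGeneralSolution_iff {f₁ : Fun} (h0 : f₁ ≠ 0) (hd0 : dX f₁ ≠ 0) (p : Coeffs) :
    IsGeneralSolution f₁ p ↔ ClearedSolution f₁ p := by
  have ne {f : Fun} (hf : f ≠ 0) : frac f ≠ 0 := (map_ne_zero_iff frac frac_injective).2 hf
  have hT : frac T * frac Tinv = 1 := by rw [← map_mul, T_mul_Tinv, map_one]
  have hTi : frac Tinv = (frac T)⁻¹ := eq_inv_of_mul_eq_one_right hT
  have hTS : 2 * (frac hF * frac sinhHXdivH) = frac T - (frac T)⁻¹ := by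
    rw [← hTi, ← map_sub, ← two_mul_hF_mul_sinhHXdivH, map_mul, map_mul, map_ofNat]
  have hTc : 2 * frac coshHX = frac T + (frac T)⁻¹ := by
    rw [← hTi, ← map_add, ← two_mul_coshHX, map_mul, map_ofNat]
  obtain ⟨e1, e2, e3, e4, e5⟩ := field_solution_iff (f₂ := frac p.f₂) (d₂ := frac (dX p.f₂))
    (f₃ := frac p.f₃) (u := frac p.u) (v := frac p.v) (w := frac p.w)
    (left_ne_zero_of_mul_eq_one hT) (ne hF_ne_zero) (ne sinhHXdivH_ne_zero) (ne h0)
    (ne hd0) hTS hTc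
  rw [IsGeneralSolution, ClearedSolution, derivT, derivT, derivX_eq, derivX_eq]
  refine and_congr (e1.trans ?_) (and_congr (e2.trans ?_) (and_congr (e3.trans ?_)
    (and_congr (e4.trans ?_) (e5.trans ?_))))
  all_goals
    rw [← frac_injective.eq_iff]
    simp only [map_mul, map_add, map_sub, map_neg, map_pow, map_ofNat, map_one]

lemma ClearedSolution.unique {f₁ : Fun} (h0 : f₁ ≠ 0) (hd0 : dX f₁ ≠ 0) {p q : Coeffs}
    (hp : ClearedSolution f₁ p) (hq : ClearedSolution f₁ q) : p = q := by
  obtain ⟨f₂, f₃, u, v, w⟩ := p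
  obtain ⟨f₂', f₃', u', v', w'⟩ := q
  obtain ⟨a1, a2, a3, a4, a5⟩ := hp
  obtain ⟨b1, b2, b3, b4, b5⟩ := hq
  dsimp only at *
  obtain rfl : f₂ = f₂' :=
    mul_right_cancel₀ (mul_ne_zero sinhHXdivH_ne_zero hd0) (by linear_combination a1 - b1)
  have h4 : (4 : Fun) * f₁ ≠ 0 := mul_ne_zero (OfNat.ofNat_ne_zero 4) h0
  have e3 : f₃ = f₃' := mul_left_cancel₀ h0 (a2.trans b2.symm)
  have eu : u = u' := mul_left_cancel₀ h4 (a3.trans b3.symm)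
  have ev : v = v' := mul_left_cancel₀ (mul_ne_zero (mul_ne_zero two_ne_zero h0) hd0)
    (by linear_combination a4 - b4)
  have ew : w = w' := mul_left_cancel₀ h4 (by linear_combination a5 - b5)
  rw [e3, eu, ev, ew]

lemma exists_inv_of_constantCoeff_eq_one {f : Fun} (h : constantCoeff f = 1) :
    ∃ g : Fun, f * g = 1 ∧ constantCoeff g = 1 := by
  have hu : IsUnit f := by rw [PowerSeries.isUnit_iff_constantCoeff, h]; exact isUnit_one
  obtain ⟨g, hg⟩ := hu.exists_right_inv
  refine ⟨g, hg, ?_⟩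
  have h1 := congrArg constantCoeff hg
  rwa [map_mul, h, one_mul, map_one] at h1

/-- If `f₁` vanishes at `X = 0`, the quotients in the explicit expressions exist among the
functions: `f₁ = X g` and `sinh hX = h X s` with `g`, `s` and `∂f₁` invertible, and the numerators
of `v` and `w` vanish at `X = 0`. -/
lemma exists_clearedSolution {f₁ : Fun} (hf₁ : constantCoeff f₁ = Polynomial.X)
    (h0 : evalOne f₁ = 0) : ∃ p : Coeffs, p.HasClassicalLimits ∧ ClearedSolution f₁ p := by
  set x : Fun := C Polynomial.X with hx
  have hx0 : constantCoeff x = Polynomial.X := constantCoeff_C _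
  have hdx : dX x = 1 := by rw [hx, dX_C, Polynomial.derivative_X, map_one]
  have hex : evalOne x = 0 := evalOne_C_X
  have lim_of_x_mul {a : Fun} {b : Polynomial ℂ} (h : constantCoeff (x * a) = Polynomial.X * b) :
      constantCoeff a = b := by
    rw [map_mul, hx0] at h
    exact mul_left_cancel₀ Polynomial.X_ne_zero h
  obtain ⟨g, hg⟩ := exists_eq_C_X_mul h0
  obtain ⟨s, hs⟩ := exists_eq_C_X_mul evalOne_sinhHXdivH
  rw [← hx] at hg hs
  have lg : constantCoeff g = 1 := lim_of_x_mul (by rw [← hg, hf₁, mul_one])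
  have ls : constantCoeff s = 1 :=
    lim_of_x_mul (by rw [← hs, constantCoeff_sinhHXdivH, mul_one])
  have ld : constantCoeff (dX f₁) = 1 := by
    rw [constantCoeff_dX, hf₁, Polynomial.derivative_X]
  obtain ⟨g', hg', lg'⟩ := exists_inv_of_constantCoeff_eq_one lg
  obtain ⟨s', hs', ls'⟩ := exists_inv_of_constantCoeff_eq_one ls
  obtain ⟨d', hd', ld'⟩ := exists_inv_of_constantCoeff_eq_one ld
  have q4 : (4 : Fun) * C (Polynomial.C 4⁻¹) = 1 := by
    rw [← map_ofNat (C : _ →+* Fun) 4, ← map_ofNat Polynomial.C 4, ← map_mul, ← map_mul]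
    norm_num
  have q2 : (2 : Fun) * C (Polynomial.C 2⁻¹) = 1 := by
    rw [← map_ofNat (C : _ →+* Fun) 2, ← map_ofNat Polynomial.C 2, ← map_mul, ← map_mul]
    norm_num
  set f₂ : Fun := g * s' * d' with hf₂
  have h1 : f₂ * sinhHXdivH * dX f₁ = f₁ := by
    rw [hs, hf₂]
    linear_combination (g * x * dX f₁ * d') * hs' + g * x * hd' - hg
  have l2 : constantCoeff f₂ = 1 := by rw [hf₂, map_mul, map_mul, lg, ls', ld']; simp
  have es : evalOne s = 1 := by
    rw [← evalOne_coshHX, ← dX_sinhHXdivH, hs, dX_mul, hdx, map_add, map_mul, map_mul, hex]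
    simp
  have ed : evalOne (dX f₁) = evalOne g := by
    rw [hg, dX_mul, hdx, map_add, map_mul, map_mul, hex]
    simp
  have e2 : evalOne f₂ = 1 := by
    have a1 := congrArg evalOne hs'
    have a2 := congrArg evalOne hd'
    simp only [map_mul, map_one, es, ed] at a1 a2
    rw [hf₂, map_mul, map_mul]
    linear_combination evalOne g * evalOne d' * a1 + a2
  obtain ⟨k, hk⟩ := exists_eq_C_X_mul (f := 1 - f₂ ^ 2) (by
    rw [map_sub, map_pow, e2]; simp)
  obtain ⟨m, hm⟩ := exists_eq_C_X_mul (f := -(dX f₂ * f₁ - f₂ * dX f₁ + coshHX * dX f₁)) (by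
    simp only [map_neg, map_add, map_sub, map_mul, h0, e2, evalOne_coshHX]; ring)
  rw [← hx] at hk hm
  have lk : constantCoeff k = 0 := lim_of_x_mul (by rw [← hk, map_sub, map_pow, l2]; simp)
  have lm : constantCoeff m = 0 := lim_of_x_mul (by
    rw [← hm]
    simp only [map_neg, map_add, map_sub, map_mul, constantCoeff_dX, l2, hf₁,
      constantCoeff_coshHX]
    simp)
  refine ⟨⟨f₂, s * g', -(C (Polynomial.C 4⁻¹) * hF ^ 2 * x * s ^ 2 * g'),
    C (Polynomial.C 2⁻¹) * m * g' * d', C (Polynomial.C 4⁻¹) * k * g'⟩,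
    ⟨l2, ?_, ?_, ?_, ?_⟩, h1, ?_, ?_, ?_, ?_⟩ <;> dsimp only [classicalLimit]
  · rw [map_mul, ls, lg', mul_one]
  · simp [hF]
  · simp [lm]
  · simp [lk]
  · rw [hs]
    linear_combination s * g' * hg + x * s * hg'
  · rw [hs]
    linear_combination (-(4 * C (Polynomial.C 4⁻¹) * hF ^ 2 * x * s ^ 2 * g')) * hg
      - x ^ 2 * s ^ 2 * hF ^ 2 * g' * g * q4 - x ^ 2 * s ^ 2 * hF ^ 2 * hg'
  · rw [hm]
    linear_combination 2 * C (Polynomial.C 2⁻¹) * m * g' * d' * dX f₁ * hg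
      + m * g' * g * d' * dX f₁ * x * q2 + m * x * d' * dX f₁ * hg' + m * x * hd'
  · rw [hk]
    linear_combination 4 * C (Polynomial.C 4⁻¹) * k * g' * hg + k * g' * g * x * q4 + k * x * hg'

end Jordanian

end

theorem mainTheorem2 (f₁ : Jordanian.Fun)
    (hf₁ : Jordanian.classicalLimit f₁ = Polynomial.X) :
    (∀ p : Jordanian.Coeffs, p.HasClassicalLimits →
      (Jordanian.SatisfiesSl2 (Jordanian.Jplus f₁) (Jordanian.Jzero p) (Jordanian.Jminus p) ↔
        Jordanian.IsGeneralSolution f₁ p)) ∧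
    ((∃ p : Jordanian.Coeffs, p.HasClassicalLimits ∧
      Jordanian.SatisfiesSl2 (Jordanian.Jplus f₁) (Jordanian.Jzero p) (Jordanian.Jminus p)) ↔
        Jordanian.valueAtOne f₁ = 0) ∧
    (Jordanian.valueAtOne f₁ = 0 →
      ∃! p : Jordanian.Coeffs, p.HasClassicalLimits ∧
        Jordanian.SatisfiesSl2 (Jordanian.Jplus f₁) (Jordanian.Jzero p)
          (Jordanian.Jminus p)) := by
  open Jordanian in
  have hlim : PowerSeries.constantCoeff (dX f₁) = 1 := by
    rw [constantCoeff_dX, show PowerSeries.constantCoeff f₁ = Polynomial.X from hf₁,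
      Polynomial.derivative_X]
  have h0 : f₁ ≠ 0 := by
    rintro rfl
    exact Polynomial.X_ne_zero (hf₁.symm.trans (map_zero _))
  have hev : evalOne (dX f₁) ≠ 0 := by
    intro h
    have h1 := coeff_evalOne (dX f₁) 0
    rw [h, PowerSeries.coeff_zero_eq_constantCoeff_apply (dX f₁), hlim] at h1
    simp at h1
  have hd0 : dX f₁ ≠ 0 := fun h => hev (by rw [h, map_zero])
  have hiff (p : Coeffs) : SatisfiesSl2 (Jplus f₁) (Jzero p) (Jminus p) ↔ ClearedSolution f₁ p :=
    (satisfiesSl2_iff_coeffEqs f₁ p).trans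
      ⟨CoeffEqs.clearedSolution hev, ClearedSolution.coeffEqs h0 hd0⟩
  simp only [hiff, valueAtOne_eq]
  refine ⟨fun p _ => (isGeneralSolution_iff h0 hd0 p).symm, ⟨?_, exists_clearedSolution hf₁⟩,
    fun h => ?_⟩
  · rintro ⟨p, -, h1, -⟩
    rw [← h1, map_mul, map_mul, evalOne_sinhHXdivH, mul_zero, zero_mul]
  · obtain ⟨p, hp, hsol⟩ := exists_clearedSolution hf₁ h
    exact ⟨p, ⟨hp, hsol⟩, fun q hq => ClearedSolution.unique h0 hd0 hq.2 hsol⟩
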